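/- For $n\ge 1$ let $\mathbb{N}_+=\{1,2,3,\dots\}$ and let a block code of length $n$ be a binary prefix code for the words $x^n\in\mathbb{N}_+^n$, i.e. a map $c_n:\mathbb{N}_+^n\to\{0,1\}^*$ such that no codeword is a prefix of the codeword of a different word; let $L_n(x^n)$ be the length of $c_n(x^n)$. Let $\mathcal{M}$ be the set of monotonic probability distributions $\theta=(\theta_1\ge\theta_2\ge\cdots)$ on $\mathbb{N}_+$ (finite alphabets $\{1,\dots,k\}$ are included, with $\theta_i=0$ for $i>k$). For $\theta\in\mathcal{M}$ let $$H_\theta(X)=-\sum_{i\ge1}\theta_i\log_2\theta_i\in[0,\infty],\qquad R_n(L_n,\theta)=\frac1n\,E_\theta\big[L_n(X^n)\big]-H_\theta(X)\quad\text{if } H_\theta(X)<\infty,$$ where $X^n=(X_1,\dots,X_n)$ is i.i.d. with marginal $\theta$. **Corollary.** Sequences generated by monotonic distributions with $H_\theta(X)=O(1)$ are universally compressible in the average sense, that is, with diminishing per-symbol redundancy: there is a single family of block codes $(c_n)_{n\ge1}$, not depending on the source, such that for every sequence $(\theta^{(n)})_{n\ge1}$ in $\mathcal{M}$ with $H_{\theta^{(n)}}(X)=O(1)$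 as $n\to\infty$, $$\lim_{n\to\infty}R_n\big(L_n,\theta^{(n)}\big)=0 .$$ (Equivalently, for every $C<\infty$, the supremum of $R_n(L_n,\theta)$ over all $\theta\in\mathcal{M}$ with $H_\theta(X)\le C$ tends to $0$. In particular $R_n(L_n,\theta)\to0$ for every fixed $\theta\in\mathcal{M}$ of finite entropy.) -/

import Mathlib

open Filter Topology
open scoped ENNReal NNReal

namespace UnivMono

/-- A binary prefix code for the source alphabet `α`: no codeword is a prefix of the codeword of
a different source word (in particular the encoder is injective). -/
structure PrefixCode (α : Type*) where
  /-- The encoder. -/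
  encode : α → List Bool
  prefix_free : ∀ x y, encode x <+: encode y → x = y

/-- The length function `L` of a code, in bits. -/
def PrefixCode.len {α : Type*} (c : PrefixCode α) (x : α) : ℕ := (c.encode x).length

/-- The class of monotonic distributions `θ₁ ≥ θ₂ ≥ ⋯` on the positive integers. A distribution on
the finite alphabet `{1, …, k}` is the case `θ i = 0` for `i > k`. -/
def MonotonicDist : Set (PMF ℕ+) := {θ | ∀ i j : ℕ+, i ≤ j → θ j ≤ θ i}

/-- The probability of the word `xⁿ = (x₁, …, xₙ)` under the i.i.d. source with marginal `θ`. -/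
noncomputable def iidProb (θ : PMF ℕ+) {n : ℕ} (x : Fin n → ℕ+) : ℝ≥0∞ := ∏ i, θ (x i)

/-- The entropy `H_θ(X) = ∑ᵢ -θᵢ log₂ θᵢ` in bits, possibly infinite; all terms are nonnegative. -/
noncomputable def entropy (θ : PMF ℕ+) : ℝ≥0∞ :=
  ∑' i : ℕ+, ENNReal.ofReal (-((θ i).toReal * Real.logb 2 (θ i).toReal))

/-- The expected code length `E_θ L(Xⁿ)`, possibly infinite. -/
noncomputable def expectedLen {n : ℕ} (c : PrefixCode (Fin n → ℕ+)) (θ : PMF ℕ+) : ℝ≥0∞ :=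
  ∑' x : Fin n → ℕ+, iidProb θ x * (c.len x : ℝ≥0∞)

/-- The average per-symbol redundancy `Rₙ(L, θ) = (1/n) E_θ L(Xⁿ) - H_θ(X)`. It is used only for
sources of finite entropy, so that no difference `∞ - ∞` occurs; the value is `∞` if the expected
length is infinite. -/
noncomputable def redundancy {n : ℕ} (c : PrefixCode (Fin n → ℕ+)) (θ : PMF ℕ+) : EReal :=
  ((expectedLen c θ / (n : ℝ≥0∞) : ℝ≥0∞) : EReal) - ((entropy θ : ℝ≥0∞) : EReal)

end UnivMono

namespace UnivMono

/-! Keep the letters up to `m = log₂ n` and merge the rest into one escape symbol. The truncated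
word is sent as its type plus its index in the type class, which is universal for memoryless sources
at a cost of O(log² n) = o(n) bits (`exists_wordCode`). Each escaped letter is then resolved by its
Elias delta codeword. Monotonicity gives `a * θ a ≤ 1`, so `log₂ a ≤ -log₂ θ a`, and for large `a`
the Elias codeword costs at most `1 + ε` times the self-information of `a`. The only other loss is
the term `t * info t`, with `t` the escape probability; a Markov bound `t * log₂ m ≤ H` makes it
vanish uniformly for bounded entropy (`tsum_mul_letterCost_le`, `eventually_tailProb_mul_info_le`).
Nonnegativity of the redundancy is Kraft plus Gibbs (`PrefixCode.tsum_mul_info_le`). -/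

/-- No codeword is a prefix of the codeword of a different source word. -/
def PrefixFree {α : Type*} (e : α → List Bool) : Prop := ∀ x y, e x <+: e y → x = y

/-- Two prefixes of one word are comparable, so the headers agree and cancel. Hence `B` only has to
be prefix-free on each fibre of `f`. -/
theorem PrefixFree.append {α β : Type*} {A : β → List Bool} {B : α → List Bool} {f : α → β}
    (hA : PrefixFree A) (hB : ∀ x y, f x = f y → B x <+: B y → x = y) :
    PrefixFree (fun x => A (f x) ++ B x) := by
  intro x y h
  have hf : f x = f y := by
    rcases List.prefix_or_prefix_of_prefix ((List.prefix_append _ _).trans h)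
      (List.prefix_append (A (f y)) (B y)) with h' | h'
    · exact hA _ _ h'
    · exact (hA _ _ h').symm
  refine hB x y hf ?_
  simp only [hf] at h
  exact (List.prefix_append_right_inj _).1 h

/-- The unary code. -/
def unaryCode (k : ℕ) : List Bool := List.replicate k true ++ [false]

theorem prefixFree_unaryCode : PrefixFree unaryCode := by
  intro x
  induction x with
  | zero =>
    intro y h
    cases y with
    | zero => rfl
    | succ y => simp [unaryCode, List.replicate_succ] at h
  | succ x ih =>
    intro y h
    cases y with
    | zero => simp [unaryCode, List.replicate_succ] at h
    | succ y =>
      simp only [unaryCode, List.replicate_succ, List.cons_append, List.cons_prefix_cons] at h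
      rw [ih y h.2]

theorem bits_injective : Function.Injective Nat.bits := by
  refine Function.LeftInverse.injective (g := fun l => l.foldr Nat.bit 0) fun n => ?_
  induction n using Nat.binaryRec' with
  | zero => simp
  | bit b n h ih =>
    rw [Nat.bits_append_bit _ _ h]
    exact congrArg (Nat.bit b) ih

/-- Prepend to the binary expansion a codeword for its length. -/
def sizeCode (A : ℕ → List Bool) (k : ℕ) : List Bool := A k.size ++ k.bits

theorem PrefixFree.sizeCode {A : ℕ → List Bool} (hA : PrefixFree A) :
    PrefixFree (sizeCode A) := by
  refine hA.append (f := Nat.size) (B := Nat.bits) fun x y hs h => ?_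
  have := h.eq_of_length (by rw [Nat.size_eq_bits_len, Nat.size_eq_bits_len, hs])
  exact bits_injective this

/-- The Elias delta code. -/
def eliasCode : ℕ → List Bool := sizeCode (sizeCode unaryCode)

theorem prefixFree_eliasCode : PrefixFree eliasCode := prefixFree_unaryCode.sizeCode.sizeCode

theorem length_eliasCode (k : ℕ) :
    (eliasCode k).length = k.size + 2 * k.size.size + 1 := by
  simp [eliasCode, sizeCode, unaryCode, Nat.size_eq_bits_len]
  ring

/-- A finite set has a fixed-length code. -/
theorem exists_fixedLength {α : Type*} (S : Finset α) :
    ∃ e : α → List Bool, (∀ x, (e x).length = Nat.clog 2 S.card) ∧ Set.InjOn e S := by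
  classical
  have hc : Fintype.card S ≤ Fintype.card (List.Vector Bool (Nat.clog 2 S.card)) := by
    simpa using Nat.le_pow_clog one_lt_two S.card
  obtain ⟨f⟩ := Function.Embedding.nonempty_of_card_le hc
  -- Off `S` the value is junk of the same length, so the length formula needs no membership
  -- hypothesis.
  refine ⟨fun x => if h : x ∈ S then (f ⟨x, h⟩).toList else List.replicate (Nat.clog 2 S.card) true, fun x => ?_,
    fun x hx y hy h => ?_⟩
  · dsimp only
    split_ifs <;> simp
  · have hx' : x ∈ S := hx
    have hy' : y ∈ S := hy
    simp only [hx', hy', dif_pos] at h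
    simpa using f.injective (List.Vector.toList_injective h)

/-- Decodability is asked only of the letters paired in the two lists: `escapeCode` is empty on
every kept letter and so is not prefix-free by itself. -/
theorem flatMap_prefix_inj {α : Type*} {e : α → List Bool} {l₁ l₂ : List α}
    (hl : List.Forall₂ (fun a b => e a <+: e b ∨ e b <+: e a → a = b) l₁ l₂)
    (h : l₁.flatMap e <+: l₂.flatMap e) : l₁ = l₂ := by
  induction hl with
  | nil => rfl
  | @cons a b l₁ l₂ hab _ ih =>
    simp only [List.flatMap_cons] at h
    obtain rfl := hab (List.prefix_or_prefix_of_prefix ((List.prefix_append _ _).trans h)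
      (List.prefix_append (e b) _))
    rw [ih ((List.prefix_append_right_inj _).1 h)]

/-! ### Kraft inequality -/

theorem PrefixCode.encode_injective {α : Type*} (c : PrefixCode α) :
    Function.Injective c.encode :=
  fun x y h => c.prefix_free x y (h ▸ List.prefix_rfl)

/-- A one-word source may use the empty codeword, which would break unique decodability. -/
theorem PrefixCode.encode_ne_nil {α : Type*} [Nontrivial α] (c : PrefixCode α) (x : α) :
    c.encode x ≠ [] := by
  intro h
  obtain ⟨y, hy⟩ := exists_ne x
  exact hy (c.prefix_free x y (h ▸ List.nil_prefix)).symm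

theorem PrefixCode.uniquelyDecodable {α : Type*} [Nontrivial α] (c : PrefixCode α) :
    InformationTheory.UniquelyDecodable (Set.range c.encode) := by
  intro L₁
  induction L₁ with
  | nil =>
    intro L₂ _ h₂ h
    cases L₂ with
    | nil => rfl
    | cons b L₂ =>
      obtain ⟨y, rfl⟩ := h₂ b (by simp)
      exact absurd (List.append_eq_nil_iff.1 h.symm).1 (c.encode_ne_nil y)
  | cons a L₁ ih =>
    intro L₂ h₁ h₂ h
    obtain ⟨x, rfl⟩ := h₁ a (by simp)
    cases L₂ with
    | nil => exact absurd (List.append_eq_nil_iff.1 h).1 (c.encode_ne_nil x)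
    | cons b L₂ =>
      obtain ⟨y, rfl⟩ := h₂ b (by simp)
      simp only [List.flatten_cons] at h
      have hxy : x = y := by
        rcases List.prefix_or_prefix_of_prefix (h ▸ List.prefix_append _ _)
          (List.prefix_append (c.encode y) L₂.flatten) with h' | h'
        · exact c.prefix_free _ _ h'
        · exact (c.prefix_free _ _ h').symm
      subst hxy
      rw [ih L₂ (fun w hw => h₁ w (by simp [hw])) (fun w hw => h₂ w (by simp [hw]))
        (List.append_cancel_left h)]

/-- The Kraft inequality for prefix codes over a countable source alphabet. -/
theorem PrefixCode.kraft {α : Type*} [Nontrivial α] (c : PrefixCode α) :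
    ∑' x, ENNReal.ofReal ((1 / 2) ^ c.len x) ≤ 1 := by
  classical
  rw [ENNReal.tsum_eq_iSup_sum]
  refine iSup_le fun s => ?_
  rw [← ENNReal.ofReal_sum_of_nonneg (fun _ _ => by positivity)]
  refine ENNReal.ofReal_le_one.2 ?_
  have hu : InformationTheory.UniquelyDecodable ((s.image c.encode : Finset _) : Set (List Bool)) :=
    fun L₁ L₂ h₁ h₂ h => c.uniquelyDecodable L₁ L₂
      (fun w hw => by have := h₁ w hw; simp at this; exact ⟨_, this.choose_spec.2⟩)
      (fun w hw => by have := h₂ w hw; simp at this; exact ⟨_, this.choose_spec.2⟩) h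
  have := InformationTheory.kraft_mcmillan_inequality hu
  rw [Finset.sum_image c.encode_injective.injOn] at this
  simpa [PrefixCode.len] using this

/-! ### Self-information and i.i.d. sums -/

/-- The self-information `-log₂ p` of an event of probability `p`; it is `0` for `p = 0`. -/
noncomputable def info (p : ℝ≥0∞) : ℝ≥0∞ := ENNReal.ofReal (-Real.logb 2 p.toReal)

theorem logb_toReal_nonpos {p : ℝ≥0∞} (hp : p ≤ 1) : Real.logb 2 p.toReal ≤ 0 :=
  Real.logb_nonpos one_lt_two ENNReal.toReal_nonneg
    (by simpa using ENNReal.toReal_mono ENNReal.one_ne_top hp)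

theorem mul_info {p : ℝ≥0∞} (hp : p ≤ 1) :
    p * info p = ENNReal.ofReal (-(p.toReal * Real.logb 2 p.toReal)) := by
  have h : p ≠ ∞ := ne_top_of_le_ne_top ENNReal.one_ne_top hp
  rw [info, ← mul_neg, ENNReal.ofReal_mul ENNReal.toReal_nonneg, ENNReal.ofReal_toReal h]

theorem info_anti {p q : ℝ≥0∞} (h0 : p ≠ 0) (h : p ≤ q) (hq : q ≠ ∞) : info q ≤ info p := by
  refine ENNReal.ofReal_le_ofReal (neg_le_neg ?_)
  have hp : p ≠ ∞ := ne_top_of_le_ne_top hq h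
  exact Real.logb_le_logb_of_le one_lt_two (ENNReal.toReal_pos h0 hp) (ENNReal.toReal_mono hq h)

theorem info_prod {ι : Type*} (s : Finset ι) {p : ι → ℝ≥0∞} (hp : ∀ i ∈ s, p i ≤ 1)
    (h0 : ∏ i ∈ s, p i ≠ 0) : info (∏ i ∈ s, p i) = ∑ i ∈ s, info (p i) := by
  simp only [info]
  rw [← ENNReal.ofReal_sum_of_nonneg fun i hi => neg_nonneg.2 (logb_toReal_nonpos (hp i hi)),
    ENNReal.toReal_prod, Real.logb_prod, Finset.sum_neg_distrib]
  intro i hi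
  have : p i ≠ ∞ := ne_top_of_le_ne_top ENNReal.one_ne_top (hp i hi)
  exact (ENNReal.toReal_pos (fun h => h0 (Finset.prod_eq_zero hi h)) this).ne'

theorem entropy_eq (θ : PMF ℕ+) : entropy θ = ∑' a, θ a * info (θ a) :=
  tsum_congr fun a => (mul_info (θ.coe_le_one a)).symm

theorem tsum_pi_prod {α : Type*} {n : ℕ} (f : Fin n → α → ℝ≥0∞) :
    ∑' x : Fin n → α, ∏ i, f i (x i) = ∏ i, ∑' a, f i a := by
  induction n with
  | zero => simp
  | succ n ih =>
    rw [← (Fin.consEquiv fun _ : Fin (n + 1) => α).tsum_eq, ENNReal.tsum_prod',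
      Fin.prod_univ_succ, ← ih fun i => f i.succ]
    simp only [Fin.consEquiv_apply, Fin.prod_univ_succ, Fin.cons_zero, Fin.cons_succ,
      ENNReal.tsum_mul_left, ENNReal.tsum_mul_right]

theorem tsum_iidProb (θ : PMF ℕ+) (n : ℕ) : ∑' x : Fin n → ℕ+, iidProb θ x = 1 := by
  simp [iidProb, tsum_pi_prod fun _ : Fin n => (θ : ℕ+ → ℝ≥0∞), θ.tsum_coe]

theorem tsum_iidProb_mul (θ : PMF ℕ+) {n : ℕ} (g : ℕ+ → ℝ≥0∞) (i : Fin n) :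
    ∑' x : Fin n → ℕ+, iidProb θ x * g (x i) = ∑' a, θ a * g a := by
  -- Put the weight `g` on coordinate `i` alone; every other factor sums to one.
  have h := tsum_pi_prod fun (j : Fin n) (a : ℕ+) => θ a * if j = i then g a else 1
  simp only [Finset.prod_mul_distrib, Finset.prod_ite_eq', Finset.mem_univ, if_true] at h
  rw [show (∑' x : Fin n → ℕ+, iidProb θ x * g (x i)) = _ from h, ← Finset.mul_prod_erase _ _
    (Finset.mem_univ i), Finset.prod_eq_one, mul_one]
  · simp
  · intro j hj
    simp [Finset.ne_of_mem_erase hj, θ.tsum_coe]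

theorem tsum_iidProb_mul_sum (θ : PMF ℕ+) (n : ℕ) (g : ℕ+ → ℝ≥0∞) :
    ∑' x : Fin n → ℕ+, iidProb θ x * ∑ i, g (x i) = n * ∑' a, θ a * g a := by
  simp only [Finset.mul_sum]
  rw [Summable.tsum_finsetSum fun _ _ => ENNReal.summable]
  simp [tsum_iidProb_mul]

theorem tsum_iidProb_mul_info (θ : PMF ℕ+) (n : ℕ) :
    ∑' x : Fin n → ℕ+, iidProb θ x * info (iidProb θ x) = n * entropy θ := by
  rw [entropy_eq, ← tsum_iidProb_mul_sum]
  refine tsum_congr fun x => ?_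
  by_cases h : iidProb θ x = 0
  · simp [h]
  · rw [← info_prod _ (fun i _ => θ.coe_le_one _) h]
    rfl

/-- Pointwise Gibbs inequality, `log u ≤ u - 1` at `u = 2⁻ˡ / p`, arranged without subtraction so
that it can be summed in `ℝ≥0∞`. -/
theorem mul_info_add_le {p : ℝ≥0∞} (hp : p ≤ 1) (l : ℕ) :
    p * info p + ENNReal.ofReal (Real.log 2)⁻¹ * p ≤
      p * l + ENNReal.ofReal (Real.log 2)⁻¹ * ENNReal.ofReal ((1 / 2) ^ l) := by
  rcases eq_or_ne p 0 with rfl | h0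
  · simp
  have ht : p ≠ ∞ := ne_top_of_le_ne_top ENNReal.one_ne_top hp
  rw [mul_info hp]
  obtain ⟨t, rfl⟩ : ∃ t : ℝ≥0, p = t := ⟨p.toNNReal, (ENNReal.coe_toNNReal ht).symm⟩
  have t0 : (0 : ℝ) < t := by
    have : t ≠ 0 := by simpa using h0
    positivity
  have hl2 : 0 < Real.log 2 := Real.log_pos one_lt_two
  have hneg : 0 ≤ -((t : ℝ) * Real.logb 2 t) := by
    have := logb_toReal_nonpos hp
    simp only [ENNReal.coe_toReal] at this
    nlinarith
  rw [← ENNReal.ofReal_coe_nnreal, ← ENNReal.ofReal_natCast, ← ENNReal.ofReal_mul t0.le,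
    ← ENNReal.ofReal_mul (by positivity), ← ENNReal.ofReal_mul (by positivity),
    ENNReal.toReal_ofReal t0.le, ← ENNReal.ofReal_add hneg (by positivity),
    ← ENNReal.ofReal_add (by positivity) (by positivity)]
  refine ENNReal.ofReal_le_ofReal ?_
  have hlog := Real.log_le_sub_one_of_pos (x := (1 / 2) ^ l / (t : ℝ)) (by positivity)
  rw [Real.log_div (by positivity) t0.ne', Real.log_pow, one_div, Real.log_inv,
    le_sub_iff_add_le, le_div_iff₀ t0] at hlog
  rw [Real.logb, one_div]
  field_simp
  rw [one_div, inv_pow]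
  rw [inv_pow] at hlog
  linarith

/-- The expected length of a prefix code is at least the entropy. -/
theorem PrefixCode.tsum_mul_info_le {α : Type*} [Nontrivial α] (c : PrefixCode α)
    {p : α → ℝ≥0∞} (hp : ∑' x, p x = 1) : ∑' x, p x * info (p x) ≤ ∑' x, p x * c.len x := by
  set k := ENNReal.ofReal (Real.log 2)⁻¹
  have h := ENNReal.tsum_le_tsum fun x =>
    mul_info_add_le (hp ▸ ENNReal.le_tsum x : p x ≤ 1) (c.len x)
  rw [ENNReal.tsum_add, ENNReal.tsum_add, ENNReal.tsum_mul_left, ENNReal.tsum_mul_left, hp] at h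
  have hk := c.kraft
  refine (ENNReal.add_le_add_iff_right (a := k * 1) (by simp [k])).1 (h.trans ?_)
  gcongr

theorem entropy_le_expectedLen {n : ℕ} (hn : n ≠ 0) (c : PrefixCode (Fin n → ℕ+)) (θ : PMF ℕ+) :
    n * entropy θ ≤ expectedLen c θ := by
  have : NeZero n := ⟨hn⟩
  rw [← tsum_iidProb_mul_info]
  exact c.tsum_mul_info_le (tsum_iidProb θ n)

/-! ### Universal coding by types -/

/-- The type of a word: the number of occurrences of each letter. -/
def wordType {n k : ℕ} (s : Fin n → Fin k) (b : Fin k) : Fin (n + 1) :=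
  ⟨(Finset.univ.filter fun i => s i = b).card, Nat.lt_succ_of_le <| by
    simpa using Finset.card_filter_le (Finset.univ : Finset (Fin n)) fun i => s i = b⟩

/-- The words of the same type as `s`. -/
def typeClass {n k : ℕ} (t : Fin k → Fin (n + 1)) : Finset (Fin n → Fin k) :=
  Finset.univ.filter fun s => wordType s = t

theorem prod_eq_of_wordType_eq {n k : ℕ} (w : Fin k → ℝ≥0∞) {s s' : Fin n → Fin k}
    (h : wordType s = wordType s') : ∏ i, w (s i) = ∏ i, w (s' i) := by
  have key (r : Fin n → Fin k) : ∏ i, w (r i) = ∏ b, w b ^ (wordType r b : ℕ) := by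
    rw [← Finset.prod_fiberwise_of_maps_to (g := r) (t := Finset.univ) (by simp)]
    refine Finset.prod_congr rfl fun b _ => ?_
    rw [Finset.prod_congr rfl fun i hi => by rw [(Finset.mem_filter.1 hi).2], Finset.prod_const]
    rfl
  rw [key, key, h]

/-- Words of one type are equiprobable, and their total mass is at most one. -/
theorem card_typeClass_mul_le {n k : ℕ} {w : Fin k → ℝ≥0∞} (hw : ∑ b, w b ≤ 1)
    (s : Fin n → Fin k) : ((typeClass (wordType s)).card : ℝ≥0∞) * ∏ i, w (s i) ≤ 1 := by
  calc ((typeClass (wordType s)).card : ℝ≥0∞) * ∏ i, w (s i)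
      = ∑ r ∈ typeClass (wordType s), ∏ i, w (r i) := by
        rw [Finset.sum_congr rfl fun r (hr : r ∈ typeClass (wordType s)) =>
          prod_eq_of_wordType_eq w (Finset.mem_filter.1 hr).2, Finset.sum_const, nsmul_eq_mul]
    _ ≤ ∑ r : Fin n → Fin k, ∏ i, w (r i) := Finset.sum_le_univ_sum_of_nonneg fun _ => zero_le
    _ = (∑ b, w b) ^ n := (Fintype.sum_pow w n).symm
    _ ≤ 1 := pow_le_one₀ zero_le hw

theorem clog_le_info_add_one {N : ℕ} {p : ℝ≥0∞} (hN : N ≠ 0) (hp : p ≠ 0) (h : N * p ≤ 1) :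
    (Nat.clog 2 N : ℝ≥0∞) ≤ info p + 1 := by
  have hp1 : p ≤ 1 := le_trans (le_mul_of_one_le_left zero_le
    (by exact_mod_cast Nat.one_le_iff_ne_zero.2 hN)) h
  have ht : p ≠ ∞ := ne_top_of_le_ne_top ENNReal.one_ne_top hp1
  have t0 := ENNReal.toReal_pos hp ht
  have h' : (N : ℝ) * p.toReal ≤ 1 := by
    simpa using ENNReal.toReal_mono ENNReal.one_ne_top h
  have N1 : (1 : ℝ) ≤ N := by exact_mod_cast Nat.one_le_iff_ne_zero.2 hN
  have h2 : Real.logb 2 N + Real.logb 2 p.toReal ≤ 0 := by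
    rw [← Real.logb_mul (by positivity) t0.ne']
    exact Real.logb_nonpos one_lt_two (by positivity) h'
  have h3 : (Nat.clog 2 N : ℝ) < Real.logb 2 N + 1 := by
    rw [← Real.natCeil_logb_natCast]
    exact_mod_cast Nat.ceil_lt_add_one (Real.logb_nonneg one_lt_two N1)
  rw [info, ← ENNReal.ofReal_one, ← ENNReal.ofReal_natCast,
    ← ENNReal.ofReal_add (neg_nonneg.2 (logb_toReal_nonpos hp1)) zero_le_one]
  exact ENNReal.ofReal_le_ofReal (by linarith)

/-- Words over a finite alphabet have a prefix code, not depending on the source, that spends at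
most `k log₂ (n + 1) + 1` bits more than the self-information of the word for any memoryless
source. -/
theorem exists_wordCode (n k : ℕ) : ∃ e : (Fin n → Fin k) → List Bool, PrefixFree e ∧
    ∀ w : Fin k → ℝ≥0∞, ∑ b, w b ≤ 1 → ∀ s, (∏ i, w (s i)) ≠ 0 →
      ((e s).length : ℝ≥0∞) ≤ (k * Nat.clog 2 (n + 1) + 1 : ℕ) + ∑ i, info (w (s i)) := by
  obtain ⟨A, hA, hAi⟩ := exists_fixedLength (Finset.univ : Finset (Fin k → Fin (n + 1)))
  choose B hB hBi using fun t : Fin k → Fin (n + 1) => exists_fixedLength (typeClass t)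
  have hAp : PrefixFree A := fun x y h =>
    hAi (by simp) (by simp) (h.eq_of_length (by rw [hA, hA]))
  refine ⟨fun s => A (wordType s) ++ B (wordType s) s, hAp.append (B := fun s => B (wordType s) s)
    fun x y hxy h => ?_, fun w hw s hs => ?_⟩
  · refine hBi (wordType x) (by simp [typeClass]) (by simp [typeClass, hxy]) ?_
    have := h.eq_of_length (by simp only [hB, hxy])
    rwa [← hxy] at this
  · have h1 : (Nat.clog 2 (Finset.univ : Finset (Fin k → Fin (n + 1))).card) ≤
        k * Nat.clog 2 (n + 1) := by
      refine Nat.clog_le_of_le_pow ?_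
      simp only [Finset.card_univ, Fintype.card_fun, Fintype.card_fin]
      rw [mul_comm, pow_mul]
      exact Nat.pow_le_pow_left (Nat.le_pow_clog one_lt_two _) _
    have hw1 (b : Fin k) : w b ≤ 1 :=
      (Finset.single_le_sum (f := w) (fun _ _ => zero_le) (Finset.mem_univ b)).trans hw
    have h2 := clog_le_info_add_one (N := (typeClass (wordType s)).card)
      (Finset.card_ne_zero.2 ⟨s, by simp [typeClass]⟩) hs (card_typeClass_mul_le hw s)
    rw [info_prod _ (fun i _ => hw1 _) hs] at h2
    rw [List.length_append, hA, hB]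
    push_cast
    calc _ ≤ ((k * Nat.clog 2 (n + 1) : ℕ) : ℝ≥0∞) + (∑ i, info (w (s i)) + 1) := by
          gcongr
      _ = _ := by push_cast; ring

/-! ### Truncation and escape -/

/-- The letters `1, …, m` are kept, all larger ones are merged into one escape symbol. -/
def truncLetter (m : ℕ) (a : ℕ+) : Fin (m + 1) :=
  ⟨min ((a : ℕ) - 1) m, Nat.lt_succ_of_le (min_le_right _ _)⟩

/-- The codeword that resolves the escape symbol. -/
def escapeCode (m : ℕ) (a : ℕ+) : List Bool := if m < (a : ℕ) then eliasCode a else []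

theorem truncLetter_eq_iff {m : ℕ} {a b : ℕ+} :
    truncLetter m a = truncLetter m b ↔ a = b ∨ (m < (a : ℕ) ∧ m < (b : ℕ)) := by
  have ha := a.pos
  have hb := b.pos
  rw [truncLetter, truncLetter, Fin.mk.injEq, ← PNat.coe_inj]
  omega

theorem eq_of_truncLetter_eq {m : ℕ} {a b : ℕ+} (h : truncLetter m a = truncLetter m b)
    (h' : escapeCode m a <+: escapeCode m b ∨ escapeCode m b <+: escapeCode m a) : a = b := by
  rcases truncLetter_eq_iff.1 h with h | ⟨ha, hb⟩
  · exact h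
  · simp only [escapeCode, ha, hb, if_true] at h'
    rcases h' with h' | h'
    · exact PNat.coe_inj.1 (prefixFree_eliasCode _ _ h')
    · exact (PNat.coe_inj.1 (prefixFree_eliasCode _ _ h')).symm

/-- The distribution of the truncated letters. -/
noncomputable def truncProb (θ : PMF ℕ+) (m : ℕ) (b : Fin (m + 1)) : ℝ≥0∞ :=
  ∑' a, if truncLetter m a = b then θ a else 0

theorem sum_truncProb (θ : PMF ℕ+) (m : ℕ) : ∑ b, truncProb θ m b = 1 := by
  simp only [truncProb]
  rw [← Summable.tsum_finsetSum fun _ _ => ENNReal.summable]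
  simp [θ.tsum_coe]

theorem truncProb_le_one (θ : PMF ℕ+) (m : ℕ) (b : Fin (m + 1)) : truncProb θ m b ≤ 1 :=
  sum_truncProb θ m ▸ Finset.single_le_sum (f := truncProb θ m) (fun _ _ => zero_le)
    (Finset.mem_univ b)

theorem le_truncProb (θ : PMF ℕ+) (m : ℕ) (a : ℕ+) : θ a ≤ truncProb θ m (truncLetter m a) := by
  refine le_trans ?_ (ENNReal.le_tsum a)
  simp

/-- The probability of the escape symbol. -/
noncomputable def tailProb (θ : PMF ℕ+) (m : ℕ) : ℝ≥0∞ := ∑' a : ℕ+, if m < (a : ℕ) then θ a else 0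

theorem truncProb_eq_tailProb (θ : PMF ℕ+) {m : ℕ} {a : ℕ+} (h : m < (a : ℕ)) :
    truncProb θ m (truncLetter m a) = tailProb θ m := by
  refine tsum_congr fun b => ?_
  congr 1
  rw [truncLetter_eq_iff, eq_iff_iff]
  constructor
  · rintro (rfl | h')
    exacts [h, h'.1]
  · exact fun h' => Or.inr ⟨h', h⟩

/-- A block code with escape threshold `m`. -/
theorem exists_blockCode (n m : ℕ) : ∃ c : PrefixCode (Fin n → ℕ+), ∀ θ : PMF ℕ+,
    expectedLen c θ ≤ ((m + 1) * Nat.clog 2 (n + 1) + 1 : ℕ) +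
      n * ∑' a, θ a * (info (truncProb θ m (truncLetter m a)) + (escapeCode m a).length) := by
  obtain ⟨e, he, hlen⟩ := exists_wordCode n (m + 1)
  refine ⟨⟨fun x => e (fun i => truncLetter m (x i)) ++ (List.ofFn x).flatMap (escapeCode m),
    he.append (B := fun x => (List.ofFn x).flatMap (escapeCode m)) fun x y hxy h => ?_⟩,
    fun θ => ?_⟩
  · refine List.ofFn_injective (flatMap_prefix_inj (List.forall₂_iff_get.2 ⟨by simp, ?_⟩) h)
    intro i _ _
    simp only [List.get_ofFn]
    exact eq_of_truncLetter_eq (congrFun hxy _)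
  · rw [expectedLen, ← tsum_iidProb_mul_sum]
    -- Write the constant overhead as an expectation, so that the bound can be checked word by word.
    conv_rhs => rw [← one_mul (Nat.cast _), ← tsum_iidProb θ n]
    rw [← ENNReal.tsum_mul_right, ← ENNReal.tsum_add]
    refine ENNReal.tsum_le_tsum fun x => ?_
    rcases eq_or_ne (iidProb θ x) 0 with h0 | h0
    · simp [h0]
    rw [← mul_add]
    gcongr
    have hl := hlen (truncProb θ m) (sum_truncProb θ m).le (fun i => truncLetter m (x i))
      (Finset.prod_ne_zero_iff.2 fun i hi h => Finset.prod_ne_zero_iff.1 h0 i hi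
        (le_antisymm (h ▸ le_truncProb θ m (x i)) zero_le))
    simp only [PrefixCode.len, List.length_append, List.length_flatMap, List.map_ofFn,
      List.sum_ofFn, Finset.sum_add_distrib, ← add_assoc, Function.comp_apply]
    push_cast at hl ⊢
    gcongr

/-! ### Growth estimates -/

theorem tendsto_natLog_atTop : Tendsto (Nat.log 2) atTop atTop :=
  tendsto_atTop_atTop_of_monotone (fun _ _ h => Nat.log_mono_right h)
    fun b => ⟨2 ^ b, (Nat.log_pow one_lt_two b).ge⟩

theorem tendsto_natLog_div {f : ℕ → ℝ} (hf : ∀ k, 0 ≤ f k)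
    (h : Tendsto (fun k => f k / 2 ^ k) atTop (𝓝 0)) :
    Tendsto (fun n : ℕ => f (Nat.log 2 n) / n) atTop (𝓝 0) := by
  refine tendsto_of_tendsto_of_tendsto_of_le_of_le' tendsto_const_nhds
    (h.comp tendsto_natLog_atTop) (Eventually.of_forall fun n => by
      have := hf (Nat.log 2 n); positivity) ?_
  filter_upwards [eventually_ne_atTop 0] with n hn
  refine div_le_div_of_nonneg_left (hf _) (by positivity) ?_
  exact_mod_cast Nat.pow_log_le_self 2 hn

theorem tendsto_quadratic_div_two_pow (a b c : ℝ) :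
    Tendsto (fun k : ℕ => (a * k ^ 2 + b * k + c) / 2 ^ k) atTop (𝓝 0) := by
  have h (i : ℕ) : Tendsto (fun k : ℕ => (k : ℝ) ^ i / 2 ^ k) atTop (𝓝 0) :=
    tendsto_pow_const_div_const_pow_of_one_lt i one_lt_two
  have := (((h 2).const_mul a).add ((h 1).const_mul b)).add ((h 0).const_mul c)
  simp only [mul_zero, add_zero] at this
  refine this.congr fun k => ?_
  simp only [pow_one, pow_zero]
  ring

theorem size_le_log_add_one (k : ℕ) : k.size ≤ Nat.log 2 k + 1 :=
  Nat.size_le.2 (Nat.lt_pow_succ_log_self one_lt_two k)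

theorem length_eliasCode_le (a : ℕ) :
    (eliasCode a).length ≤ Nat.log 2 a + (2 * Nat.log 2 (Nat.log 2 a + 1) + 4) := by
  have h1 := size_le_log_add_one a
  have h2 := (Nat.size_le_size h1).trans (size_le_log_add_one _)
  rw [length_eliasCode]
  omega

theorem eventually_length_eliasCode_le {ε : ℝ} (hε : 0 < ε) :
    ∀ᶠ a : ℕ in atTop, ((eliasCode a).length : ℝ) ≤ (1 + ε) * Real.logb 2 a := by
  -- Used at `log₂ a + 1`; the extra `ε` in the constant absorbs that `+ 1`.
  have h := tendsto_natLog_div (f := fun k => 0 * k ^ 2 + 2 * k + (4 + ε))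
    (fun k => by positivity) (tendsto_quadratic_div_two_pow 0 2 (4 + ε))
  have h' := ((tendsto_add_atTop_nat 1).comp tendsto_natLog_atTop).eventually
    (h.eventually_le_const hε)
  filter_upwards [h', eventually_ne_atTop 0] with a ha h0
  simp only [Function.comp_apply] at ha
  rw [div_le_iff₀ (by positivity)] at ha
  have hl : ((eliasCode a).length : ℝ) ≤
      Nat.log 2 a + (2 * Nat.log 2 (Nat.log 2 a + 1) + 4) := by
    exact_mod_cast length_eliasCode_le a
  have hle : (Nat.log 2 a : ℝ) ≤ Real.logb 2 a := Real.natLog_le_logb a 2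
  push_cast at ha
  nlinarith

/-! ### Consequences of monotonicity -/

theorem mul_le_one_of_mono {θ : PMF ℕ+} (hθ : θ ∈ MonotonicDist) (a : ℕ+) :
    ((a : ℕ) : ℝ≥0∞) * θ a ≤ 1 := by
  rw [← θ.tsum_coe]
  refine le_trans ?_ (ENNReal.sum_le_tsum (Finset.Icc 1 a))
  calc ((a : ℕ) : ℝ≥0∞) * θ a = ∑ _b ∈ Finset.Icc 1 a, θ a := by simp
    _ ≤ _ := Finset.sum_le_sum fun b hb => hθ _ _ (Finset.mem_Icc.1 hb).2

theorem logb_le_info {θ : PMF ℕ+} (hθ : θ ∈ MonotonicDist) {a : ℕ+} (ha : θ a ≠ 0) :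
    ENNReal.ofReal (Real.logb 2 (a : ℕ)) ≤ info (θ a) := by
  refine ENNReal.ofReal_le_ofReal ?_
  have t0 := ENNReal.toReal_pos ha (θ.apply_ne_top a)
  have h : ((a : ℕ) : ℝ) * (θ a).toReal ≤ 1 := by
    simpa using ENNReal.toReal_mono ENNReal.one_ne_top (mul_le_one_of_mono hθ a)
  have a0 : (0 : ℝ) < (a : ℕ) := by exact_mod_cast a.pos
  have := Real.logb_nonpos one_lt_two (by positivity) h
  rw [Real.logb_mul a0.ne' t0.ne'] at this
  linarith

theorem tailProb_le_one (θ : PMF ℕ+) (m : ℕ) : tailProb θ m ≤ 1 := by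
  rw [← θ.tsum_coe]
  refine ENNReal.tsum_le_tsum fun a => ?_
  split_ifs <;> simp

/-- Markov's inequality: each letter beyond `m` of positive probability has self-information at
least `log₂ m`. -/
theorem tailProb_mul_le {θ : PMF ℕ+} (hθ : θ ∈ MonotonicDist) (m : ℕ) :
    tailProb θ m * ENNReal.ofReal (Real.logb 2 m) ≤ entropy θ := by
  rw [tailProb, ← ENNReal.tsum_mul_right, entropy_eq]
  refine ENNReal.tsum_le_tsum fun a => ?_
  split_ifs with h
  · rcases eq_or_ne (θ a) 0 with h0 | h0
    · simp [h0]
    gcongr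
    refine le_trans (ENNReal.ofReal_le_ofReal ?_) (logb_le_info hθ h0)
    rcases Nat.eq_zero_or_pos m with rfl | hm
    · simpa using Real.logb_nonneg one_lt_two (by exact_mod_cast one_le (a := a))
    · exact Real.logb_le_logb_of_le one_lt_two (by exact_mod_cast hm) (by exact_mod_cast h.le)
  · simp

theorem exists_mul_info_le {ε : ℝ} (hε : 0 < ε) :
    ∃ δ : ℝ≥0∞, 0 < δ ∧ ∀ p ≤ δ, p ≤ 1 → p * info p ≤ ENNReal.ofReal ε := by
  have hc : Tendsto (fun t : ℝ => Real.negMulLog t / Real.log 2) (𝓝 0) (𝓝 0) := by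
    have := (Real.continuous_negMulLog.div_const (Real.log 2)).tendsto 0
    simpa using this
  obtain ⟨δ, hδ, h⟩ := Metric.eventually_nhds_iff.1 (hc.eventually_le_const hε)
  refine ⟨ENNReal.ofReal (δ / 2), by simpa using hδ, fun p hp hp1 => ?_⟩
  rw [mul_info hp1]
  refine ENNReal.ofReal_le_ofReal ?_
  have hp' := ENNReal.toReal_mono ENNReal.ofReal_ne_top hp
  rw [ENNReal.toReal_ofReal (by positivity)] at hp'
  have := h (y := p.toReal) (by
    rw [Real.dist_eq, sub_zero, abs_of_nonneg ENNReal.toReal_nonneg]; linarith)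
  rw [Real.negMulLog] at this
  rw [Real.logb]
  calc -(p.toReal * (Real.log p.toReal / Real.log 2))
      = -p.toReal * Real.log p.toReal / Real.log 2 := by ring
    _ ≤ ε := this

/-- The tail contribution of the escape symbol is uniformly small on sources of bounded entropy. -/
theorem eventually_tailProb_mul_info_le (C : ℝ≥0) {ε : ℝ} (hε : 0 < ε) :
    ∀ᶠ m : ℕ in atTop, ∀ θ ∈ MonotonicDist, entropy θ ≤ C →
      tailProb θ m * info (tailProb θ m) ≤ ENNReal.ofReal ε := by
  obtain ⟨δ, hδ, h⟩ := exists_mul_info_le hε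
  have hlog : Tendsto (fun m : ℕ => ENNReal.ofReal (Real.logb 2 m)) atTop (𝓝 ∞) :=
    ENNReal.tendsto_ofReal_atTop.comp
      ((Real.tendsto_logb_atTop one_lt_two).comp tendsto_natCast_atTop_atTop)
  have hdiv : Tendsto (fun m : ℕ => (C : ℝ≥0∞) / ENNReal.ofReal (Real.logb 2 m)) atTop (𝓝 0) := by
    simpa using ENNReal.Tendsto.const_div hlog (Or.inr ENNReal.coe_ne_top)
  filter_upwards [hdiv.eventually_le_const hδ, hlog.eventually_ne ENNReal.top_ne_zero]
    with m hm hm0 θ hθ hH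
  refine h _ (le_trans ?_ hm) (tailProb_le_one θ m)
  exact (ENNReal.le_div_iff_mul_le (Or.inl hm0) (Or.inl ENNReal.ofReal_ne_top)).2
    ((tailProb_mul_le hθ m).trans hH)

/-- The comparison is letter by letter: merging only lowers the self-information of a kept letter,
while an escaped one pays for the escape symbol and its Elias codeword. -/
theorem tsum_mul_letterCost_le {θ : PMF ℕ+} (hθ : θ ∈ MonotonicDist) {m : ℕ} {ε : ℝ} (hε : 0 < ε)
    (hm : ∀ a : ℕ, m ≤ a → ((eliasCode a).length : ℝ) ≤ (1 + ε) * Real.logb 2 a) :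
    ∑' a, θ a * (info (truncProb θ m (truncLetter m a)) + (escapeCode m a).length) ≤
      (1 + ENNReal.ofReal ε) * entropy θ + tailProb θ m * info (tailProb θ m) := by
  rw [entropy_eq, ← ENNReal.tsum_mul_left]
  conv_rhs => enter [2, 1]; rw [tailProb]
  rw [← ENNReal.tsum_mul_right, ← ENNReal.tsum_add]
  refine ENNReal.tsum_le_tsum fun a => ?_
  rcases eq_or_ne (θ a) 0 with h0 | h0
  · simp [h0]
  by_cases h : m < (a : ℕ)
  · have hl : ((eliasCode a).length : ℝ≥0∞) ≤ (1 + ENNReal.ofReal ε) * info (θ a) := by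
      calc ((eliasCode a).length : ℝ≥0∞)
          ≤ ENNReal.ofReal ((1 + ε) * Real.logb 2 (a : ℕ)) := by
            rw [← ENNReal.ofReal_natCast]
            exact ENNReal.ofReal_le_ofReal (hm a h.le)
        _ = (1 + ENNReal.ofReal ε) * ENNReal.ofReal (Real.logb 2 (a : ℕ)) := by
            rw [ENNReal.ofReal_mul (by positivity), ENNReal.ofReal_add zero_le_one hε.le,
              ENNReal.ofReal_one]
        _ ≤ _ := by gcongr; exact logb_le_info hθ h0
    simp only [truncProb_eq_tailProb θ h, escapeCode, h, if_true]
    calc _ ≤ θ a * (info (tailProb θ m) + (1 + ENNReal.ofReal ε) * info (θ a)) := by gcongr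
      _ = _ := by ring
  · have hi : info (truncProb θ m (truncLetter m a)) ≤ info (θ a) :=
      info_anti h0 (le_truncProb θ m a)
        (ne_top_of_le_ne_top ENNReal.one_ne_top (truncProb_le_one _ _ _))
    simp only [escapeCode, h, if_false, List.length_nil, Nat.cast_zero, add_zero, zero_mul]
    calc _ ≤ θ a * info (θ a) := by gcongr
      _ ≤ _ := le_mul_of_one_le_left zero_le le_self_add

theorem tendsto_overhead : Tendsto (fun n : ℕ =>
    ((((Nat.log 2 n + 1) * Nat.clog 2 (n + 1) + 1 : ℕ) : ℝ≥0∞) / n)) atTop (𝓝 0) := by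
  have h := tendsto_natLog_div (f := fun k => 1 * k ^ 2 + 2 * k + 2)
    (fun k => by positivity) (tendsto_quadratic_div_two_pow 1 2 2)
  have h' := ENNReal.tendsto_ofReal h
  rw [ENNReal.ofReal_zero] at h'
  refine tendsto_of_tendsto_of_tendsto_of_le_of_le' tendsto_const_nhds h'
    (Eventually.of_forall fun _ => zero_le) ?_
  filter_upwards [eventually_ne_atTop 0] with n hn
  rw [ENNReal.ofReal_div_of_pos (by positivity), ENNReal.ofReal_natCast]
  gcongr
  rw [← ENNReal.ofReal_natCast]
  refine ENNReal.ofReal_le_ofReal ?_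
  have hc : Nat.clog 2 (n + 1) ≤ Nat.log 2 n + 1 :=
    Nat.clog_le_of_le_pow (Nat.lt_pow_succ_log_self one_lt_two n)
  have : (Nat.log 2 n + 1) * Nat.clog 2 (n + 1) + 1 ≤
      1 * Nat.log 2 n ^ 2 + 2 * Nat.log 2 n + 2 := by nlinarith
  exact_mod_cast this

/-! ### Uniformly vanishing redundancy -/

/-- There are block codes whose redundancy vanishes uniformly on monotonic sources of bounded
entropy. -/
theorem exists_universal_codes : ∃ c : ∀ n : ℕ, PrefixCode (Fin n → ℕ+),
    ∀ (C : ℝ≥0) (ε : ℝ), 0 < ε → ∀ᶠ n : ℕ in atTop, ∀ θ ∈ MonotonicDist, entropy θ ≤ C →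
      expectedLen (c n) θ / n ≤ entropy θ + ENNReal.ofReal ε := by
  -- The threshold `log₂ n` tends to infinity, so tails vanish, yet slowly enough that the type
  -- overhead is o(n).
  choose c hc using fun n : ℕ => exists_blockCode n (Nat.log 2 n)
  refine ⟨c, fun C ε hε => ?_⟩
  -- With this factor the Elias excess is at most `ε / 3` whenever the entropy is at most `C`.
  have hη : 0 < ε / 3 / (C + 1) := by positivity
  obtain ⟨M, hM⟩ := eventually_atTop.1 (eventually_length_eliasCode_le hη)
  filter_upwards [tendsto_overhead.eventually_le_const
      (ENNReal.ofReal_pos.2 (by positivity : 0 < ε / 3)),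
    tendsto_natLog_atTop.eventually (eventually_tailProb_mul_info_le C (by positivity : 0 < ε / 3)),
    tendsto_natLog_atTop.eventually (eventually_ge_atTop M), eventually_ne_atTop 0]
    with n h1 h2 h3 hn θ hθ hH
  have hn' : (n : ℝ≥0∞) ≠ 0 := by exact_mod_cast hn
  have h4 : ENNReal.ofReal (ε / 3 / (C + 1)) * entropy θ ≤ ENNReal.ofReal (ε / 3) := by
    refine (mul_le_mul_right hH _).trans ?_
    rw [← ENNReal.ofReal_coe_nnreal, ← ENNReal.ofReal_mul hη.le]
    refine ENNReal.ofReal_le_ofReal ?_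
    rw [div_mul_eq_mul_div, div_le_iff₀ (by positivity)]
    nlinarith [C.coe_nonneg]
  have h5 := tsum_mul_letterCost_le hθ hη (fun a ha => hM a (h3.trans ha))
  calc expectedLen (c n) θ / n
      ≤ (((Nat.log 2 n + 1) * Nat.clog 2 (n + 1) + 1 : ℕ) + n * _) / n := by
        gcongr; exact hc n θ
    _ = (((Nat.log 2 n + 1) * Nat.clog 2 (n + 1) + 1 : ℕ) : ℝ≥0∞) / n + _ := by
        rw [ENNReal.add_div, ENNReal.mul_div_right_comm, ENNReal.div_self hn'
          (ENNReal.natCast_ne_top n), one_mul]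
    _ ≤ ENNReal.ofReal (ε / 3) +
          ((1 + ENNReal.ofReal (ε / 3 / (C + 1))) * entropy θ + ENNReal.ofReal (ε / 3)) := by
        gcongr
        exact h5.trans (by gcongr; exact h2 θ hθ hH)
    _ ≤ ENNReal.ofReal (ε / 3) + (entropy θ + ENNReal.ofReal (ε / 3) + ENNReal.ofReal (ε / 3)) := by
        rw [add_mul, one_mul]
        gcongr
    _ = entropy θ + ENNReal.ofReal ε := by
        rw [show ε = ε / 3 + (ε / 3 + ε / 3) by ring, ENNReal.ofReal_add (by positivity)
          (by positivity), ENNReal.ofReal_add (by positivity) (by positivity)]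
        ring_nf

theorem redundancy_nonneg {n : ℕ} (hn : n ≠ 0) (c : PrefixCode (Fin n → ℕ+)) {θ : PMF ℕ+}
    (hθ : entropy θ ≠ ∞) : 0 ≤ redundancy c θ := by
  refine (EReal.sub_nonneg (Or.inr (by simpa using hθ)) (Or.inr (by simp))).2 ?_
  refine EReal.coe_ennreal_le_coe_ennreal_iff.2 ?_
  rw [ENNReal.le_div_iff_mul_le (by simp [hn]) (by simp), mul_comm]
  exact entropy_le_expectedLen hn c θ

end UnivMono

theorem mainTheorem4 :
    ∃ c : ∀ n : ℕ, UnivMono.PrefixCode (Fin n → ℕ+),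
      ∀ θ : ℕ → PMF ℕ+, (∀ n, θ n ∈ UnivMono.MonotonicDist) →
        (∃ C : ℝ≥0, ∀ᶠ n in atTop, UnivMono.entropy (θ n) ≤ (C : ℝ≥0∞)) →
          Tendsto (fun n : ℕ => UnivMono.redundancy (c n) (θ n)) atTop (𝓝 (0 : EReal)) := by
  obtain ⟨c, hc⟩ := UnivMono.exists_universal_codes
  refine ⟨c, fun θ hθ ⟨C, hC⟩ => tendsto_order.2 ⟨fun a ha => ?_, fun a ha => ?_⟩⟩
  · filter_upwards [hC, eventually_ne_atTop 0] with n hn h0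
    exact ha.trans_le
      (UnivMono.redundancy_nonneg h0 _ (ne_top_of_le_ne_top ENNReal.coe_ne_top hn))
  · obtain ⟨ε, hε, hεa⟩ := EReal.lt_iff_exists_real_btwn.1 ha
    have hε' : 0 < ε := by exact_mod_cast hε
    filter_upwards [hC, hc C ε hε'] with n hn h
    refine lt_of_le_of_lt (EReal.sub_le_of_le_add ?_) hεa
    have := EReal.coe_ennreal_le_coe_ennreal_iff.2 (h (θ n) (hθ n) hn)
    rwa [EReal.coe_ennreal_add, EReal.coe_ennreal_ofReal, max_eq_left hε'.le, add_comm] at this
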